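/- Let $\mathfrak g_0$ be the Lie algebra of a compact semisimple Lie group (a finite-dimensional real Lie algebra with negative definite Killing form), let $\mathfrak g=\mathbb C\otimes_{\mathbb R}\mathfrak g_0$, and let $c:\mathfrak g\to\mathfrak g$, $c(X+iY)=X-iY$ for $X,Y\in\mathfrak g_0$. Let $W_0,\Omega_+,\Omega_-\in\mathfrak g$ satisfy $$[W_0,\Omega_\pm]=\pm2\Omega_\pm,\qquad[\Omega_+,\Omega_-]=W_0,\qquad c(\Omega_+)=-\Omega_-,$$ and suppose that $W_0$ is regular, i.e. it lies in an open Weyl chamber of a Cartan subalgebra $\mathfrak h$ of $\mathfrak g$ (so $W_0\in\mathfrak h$ and $\alpha(W_0)\neq0$ for every root $\alpha$); this includes the principal case, where $\alpha(W_0)=2$ for every simple root $\alpha$. Let $V_n=\{X\in\mathfrak g: [W_0,X]=nX\}$ for $n\in\mathbb Z$. Call $\xi\in\mathfrak g$ a highest weight vector of weight $2k$ if $[W_0,\xi]=2k\,\xi$ and $[\Omega_+,\xi]=0$, and put $\xi_l=\frac1{l!}\,\mathrm{ad}(\Omega_-)^l\,\xi$. Let $\kappa_1<\kappa_2<\dots<\kappa_I$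 be the distinct integers $k\ge1$ for which there is a nonzero highest weight vector of weight $2k$. For $1\le l\le I$ let $E_+^l$ be the real span of the vectors $X=\xi_{\kappa_l-1}$ (if $\kappa_l$ is odd), $X=i\,\xi_{\kappa_l-1}$ (if $\kappa_l$ is even), where $\xi$ runs over the highest weight vectors of weight $2\kappa_l$ with $c(\xi_j)=(-1)^j\xi_{2\kappa_l-j}$ for $0\le j\le2\kappa_l$, and let $E_0^l=iE_+^l$; these are real subspaces of $V_2$. For integers $n\ge0$ put $\tilde 0=1$ and $\tilde n=\max\{l:\kappa_l\le n\}$ for $n>0$. **Theorem.** Suppose $s\in\{1,2,\dots,\kappa_I-1\}$, and for $i\in\{1,2\}$ let $Z_{i,0},Z_{i,1},\dots,Z_{i,s+1}\in V_2$ satisfy $$Z_{i,0}\in E_0^1\oplus E_+^1,\qquad Z_{i,n+1}\in\bigoplus_{q=1}^{\tilde n}\bigl(E_0^q\oplus E_+^q\bigr)\quad(n=0,1,\dots,s).$$ Then the following vectors all lie in $\bigoplus_{q=1}^{\tilde s}\bigl(E_0^q\oplus E_+^q\bigr)$: for every $j\in\{1,\dots,s+1\}$, (i) $[[c(Z_{2,s-j+2}),Z_{1,j}],Z_{2,0}]$,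 (ii) $[[c(Z_{2,0}),Z_{1,j}],Z_{2,s-j+2}]$, (iii) $[[c(Z_{2,0}),Z_{2,s-j+2}],Z_{1,j}]$; and, for all integers $j,q$ such that the three indices $j$, $q-j+1$, $s-q+1$ all lie in $\{0,1,\dots,s+1\}$, (iv) $[[c(Z_{1,j}),Z_{2,q-j+1}],Z_{2,s-q+1}]$. -/

import Mathlib

open scoped TensorProduct

noncomputable section

namespace EYM

/-- The complexification `𝔤 = ℂ ⊗ 𝔤₀` of a real Lie algebra `𝔤₀`, with its complex Lie algebra
structure (and the underlying real vector space structure). -/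
def Cplx (g₀ : Type*) [LieRing g₀] [LieAlgebra ℝ g₀] : Type _ := ℂ ⊗[ℝ] g₀

variable {g₀ : Type*} [LieRing g₀] [LieAlgebra ℝ g₀]

instance : LieRing (Cplx g₀) := inferInstanceAs (LieRing (ℂ ⊗[ℝ] g₀))

instance : LieAlgebra ℂ (Cplx g₀) := inferInstanceAs (LieAlgebra ℂ (ℂ ⊗[ℝ] g₀))

instance : LieAlgebra ℝ (Cplx g₀) := inferInstanceAs (LieAlgebra ℝ (ℂ ⊗[ℝ] g₀))

instance : IsScalarTower ℝ ℂ (Cplx g₀) := inferInstanceAs (IsScalarTower ℝ ℂ (ℂ ⊗[ℝ] g₀))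

instance [FiniteDimensional ℝ g₀] : FiniteDimensional ℂ (Cplx g₀) :=
  inferInstanceAs (FiniteDimensional ℂ (ℂ ⊗[ℝ] g₀))

/-- Complex conjugation `c(X + iY) = X - iY` (`X, Y ∈ 𝔤₀`) of the complexification. -/
def conj : Cplx g₀ →ₗ[ℝ] Cplx g₀ :=
  (TensorProduct.map Complex.conjAe.toLinearMap LinearMap.id : ℂ ⊗[ℝ] g₀ →ₗ[ℝ] ℂ ⊗[ℝ] g₀)

/-- A real Lie algebra is the Lie algebra of a compact semisimple group: its Killing form is
negative definite. -/
def IsCompactSemisimple (g₀ : Type*) [LieRing g₀] [LieAlgebra ℝ g₀] : Prop :=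
  ∀ X : g₀, X ≠ 0 → killingForm ℝ g₀ X X < 0

/-- `[W₀, Ω₊] = 2Ω₊`, `[W₀, Ω₋] = -2Ω₋`, `[Ω₊, Ω₋] = W₀` and `c(Ω₊) = -Ω₋`. -/
structure IsCompactTriple (W₀ Ωp Ωm : Cplx g₀) : Prop where
  lie_W₀_Ωp : ⁅W₀, Ωp⁆ = (2 : ℂ) • Ωp
  lie_W₀_Ωm : ⁅W₀, Ωm⁆ = -((2 : ℂ) • Ωm)
  lie_Ωp_Ωm : ⁅Ωp, Ωm⁆ = W₀
  conj_Ωp : conj Ωp = -Ωm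

/-- `W₀` lies in an open Weyl chamber of the Cartan subalgebra `h`: it is an element of `h` on
which no root vanishes. (For the `W₀` of an `sl(2)`-triple all roots take real values, so that
this says that `W₀` is in the open fundamental chamber of a suitable base of the root system.) -/
def IsRegularIn (h : LieSubalgebra ℂ (Cplx g₀)) [h.IsCartanSubalgebra] (W₀ : Cplx g₀) : Prop :=
  ∃ hW : W₀ ∈ h, ∀ α : LieModule.Weight ℂ h (Cplx g₀), α.IsNonZero → α ⟨W₀, hW⟩ ≠ 0

/-- `V n`, the eigenspace of `ad W₀` for the integer `n`. -/
def V (W₀ : Cplx g₀) (n : ℤ) : Submodule ℂ (Cplx g₀) :=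
  (LieAlgebra.ad ℂ (Cplx g₀) W₀).eigenspace (n : ℂ)

/-- `ξ` is zero or a highest weight vector of weight `2k` for the adjoint action of the triple. -/
def IsHighest (W₀ Ωp : Cplx g₀) (k : ℕ) (ξ : Cplx g₀) : Prop :=
  ξ ∈ V W₀ (2 * k) ∧ ⁅Ωp, ξ⁆ = 0

/-- `ξ_l = (1 / l!) Ω₋ˡ · ξ`. -/
def ladder (Ωm : Cplx g₀) (l : ℕ) (ξ : Cplx g₀) : Cplx g₀ :=
  ((l.factorial : ℂ)⁻¹) • ((LieAlgebra.ad ℂ (Cplx g₀) Ωm) ^ l) ξ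

/-- A highest weight vector `ξ` of weight `2k` (or zero) with `c(ξ_l) = (-1)ˡ ξ_{2k-l}`. -/
def IsAdapted (W₀ Ωp Ωm : Cplx g₀) (k : ℕ) (ξ : Cplx g₀) : Prop :=
  IsHighest W₀ Ωp k ξ ∧
    ∀ l ≤ 2 * k, conj (ladder Ωm l ξ) = ((-1 : ℂ) ^ l) • ladder Ωm (2 * k - l) ξ

/-- The set `{k_j}` of the positive integers `k` for which `2k` is a highest weight of `𝔤` as a
module over the triple. -/
def weightSet (W₀ Ωp : Cplx g₀) : Set ℕ :=
  {k | 1 ≤ k ∧ ∃ ξ : Cplx g₀, ξ ≠ 0 ∧ IsHighest W₀ Ωp k ξ}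

/-- The number `I` of distinct positive integers `k_j`. -/
def numWeights (W₀ Ωp : Cplx g₀) : ℕ := (weightSet W₀ Ωp).ncard

/-- `κ_l` for `1 ≤ l ≤ I`: the distinct `k_j` in increasing order, `κ_1 < κ_2 < ⋯ < κ_I`. -/
def kappa (W₀ Ωp : Cplx g₀) (l : ℕ) : ℕ := Nat.nth (fun k => k ∈ weightSet W₀ Ωp) (l - 1)

/-- The map `s ↦ s̃` on the nonnegative integers: `0̃ = 1`, and `s̃ = max {l | κ_l ≤ s}` for
`s > 0`. -/
def tilde (W₀ Ωp : Cplx g₀) (s : ℕ) : ℕ :=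
  if s = 0 then 1
  else ((Finset.Icc 1 (numWeights W₀ Ωp)).filter (fun l => kappa W₀ Ωp l ≤ s)).sup id

/-- The factor in `X = ξ_{κ-1}` (`κ` odd), `X = i ξ_{κ-1}` (`κ` even). -/
def phase (k : ℕ) : ℂ := if Odd k then 1 else Complex.I

/-- `E_+^l`, the real span of the vectors `X = ξ_{κ_l-1}` (`κ_l` odd), `X = i ξ_{κ_l-1}`
(`κ_l` even), where `ξ` runs over the highest weight vectors of weight `2κ_l` with
`c(ξ_j) = (-1)ʲ ξ_{2κ_l-j}`. -/
def EPlus (W₀ Ωp Ωm : Cplx g₀) (l : ℕ) : Submodule ℝ (Cplx g₀) :=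
  Submodule.span ℝ {X | ∃ ξ, IsAdapted W₀ Ωp Ωm (kappa W₀ Ωp l) ξ ∧
    X = phase (kappa W₀ Ωp l) • ladder Ωm (kappa W₀ Ωp l - 1) ξ}

/-- `E_0^l`, the real span of the vectors `Y = iX` for the same vectors `X`. -/
def EZero (W₀ Ωp Ωm : Cplx g₀) (l : ℕ) : Submodule ℝ (Cplx g₀) :=
  Submodule.span ℝ {Y | ∃ ξ, IsAdapted W₀ Ωp Ωm (kappa W₀ Ωp l) ξ ∧
    Y = Complex.I • (phase (kappa W₀ Ωp l) • ladder Ωm (kappa W₀ Ωp l - 1) ξ)}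

/-- The sum of the spaces `E_0^q ⊕ E_+^q` over `1 ≤ q ≤ t`. -/
def filt (W₀ Ωp Ωm : Cplx g₀) (t : ℕ) : Submodule ℝ (Cplx g₀) :=
  ⨆ q ∈ Finset.Icc 1 t, EZero W₀ Ωp Ωm q ⊔ EPlus W₀ Ωp Ωm q

end EYM

end

/-!
Write `D = ad Ω₊`. For `n ≥ 1` the sum of the spaces `E_0^q ⊕ E_+^q` over `q ≤ ñ` is
`V 2 ∩ ker Dⁿ`, so membership is a matter of counting the powers of `D` that kill a vector. One
inclusion is `filt_tilde_le_levelSpace`, by the explicit action of `Ω₊` on ladder vectors. The other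
is `mem_filt_of_ad_pow_eq_zero`: if `Dⁿ Z = 0`, then `Dⁿ⁻¹ Z` is a highest weight vector of weight
`2n`, and subtracting a multiple of the corresponding ladder vector lowers `n`; that the adapted
vectors span all highest weight vectors over `ℂ` comes from the real structure `ξ ↦ c(ξ_{2k})`.

Say that a vector of `V 2` has level `a` if it is a sum of vectors of highest weight at most `2a`.
For levels `a`, `b`, `c ≥ 1` of `X`, `Y`, `Z`, Leibniz' rule alone bounds the level of `[[c(X), Y], Z]`
by `a + b + c`, whereas `a + b + c - 2` is needed. Both missing steps come from regularity: it
makes `V 0`, the centralizer of `W₀`, equal to the Cartan subalgebra, hence abelian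
(`lie_eq_zero_of_mem_V_zero`). If `H, K ∈ V 0` are killed by `Dᵖ⁺¹` and `Dʳ⁺¹`, then
`0 = Dᵖ⁺ʳ [H, K]` is a nonzero multiple of `[Dᵖ H, Dʳ K]`, so this top term vanishes
(`lie_ad_pow_eq_zero_of_lie_eq_zero`). Applied to `[c(X), Y]` and then to `[[c(X), Y], Z]`, after
writing `D c(X)`, `Y` and `Z` through elements of `V 0`, it kills the leading Leibniz term twice
(`ad_pow_lie_lie_eq_zero`).

Finally `Z_{i,n}` has level `max (n - 1) 1`, because `κ₁ = 1`, and for every triple of indices in the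
theorem these levels add up to at most `s + 2`.
-/

namespace EYM

/-! ### Top derivatives of brackets in a complex Lie algebra -/

section LieGeneral

variable {L : Type*} [LieRing L] [LieAlgebra ℂ L]

open LieAlgebra in
/-- In Leibniz' rule for `(ad e)^(p+r)` only the term of bidegree `(p, r)` survives. -/
lemma ad_pow_lie_of_pow_succ_eq_zero (e : L) {x y : L} {p r : ℕ}
    (hx : (ad ℂ L e ^ (p + 1)) x = 0) (hy : (ad ℂ L e ^ (r + 1)) y = 0) :
    (ad ℂ L e ^ (p + r)) ⁅x, y⁆ =
      (p + r).choose p • ⁅(ad ℂ L e ^ p) x, (ad ℂ L e ^ r) y⁆ := by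
  rw [LieAlgebra.ad_pow_lie, Finset.sum_eq_single (p, r)]
  · rintro ⟨i, j⟩ hij hne
    rw [Finset.HasAntidiagonal.mem_antidiagonal] at hij
    obtain hi | hj : p + 1 ≤ i ∨ r + 1 ≤ j := by
      by_contra! hlt
      exact hne (Prod.ext (by dsimp at *; omega) (by dsimp at *; omega))
    · simp [Module.End.pow_map_zero_of_le hi hx]
    · simp [Module.End.pow_map_zero_of_le hj hy]
  · intro hn
    exact absurd (Finset.HasAntidiagonal.mem_antidiagonal.mpr (Eq.refl (p + r))) hn

/-- If two commuting elements are killed by `(ad e)^(p+1)` and `(ad e)^(r+1)`, then their top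
derivatives commute as well. In an abelian zero weight space this removes the leading term of
Leibniz' rule. -/
lemma lie_ad_pow_eq_zero_of_lie_eq_zero (e : L) {x y : L} {p r : ℕ} (hxy : ⁅x, y⁆ = 0)
    (hx : (LieAlgebra.ad ℂ L e ^ (p + 1)) x = 0) (hy : (LieAlgebra.ad ℂ L e ^ (r + 1)) y = 0) :
    ⁅(LieAlgebra.ad ℂ L e ^ p) x, (LieAlgebra.ad ℂ L e ^ r) y⁆ = 0 := by
  have key := ad_pow_lie_of_pow_succ_eq_zero e hx hy
  rw [hxy, map_zero, eq_comm, ← Nat.cast_smul_eq_nsmul ℂ, smul_eq_zero] at key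
  refine key.resolve_left ?_
  exact_mod_cast (Nat.choose_pos (Nat.le_add_right p r)).ne'

/-- Two applications of the commutation of top derivatives: one lowers the level of the zero
weight vector `⁅x, y⁆`, the other the level of its bracket with `z`. The vectors `hy` and `hz`
are primitives of `y` and `z` for `ad e` in the zero weight space. -/
lemma ad_pow_lie_lie_eq_zero (e : L) {T : Set L} (hT : ∀ u ∈ T, ∀ v ∈ T, ⁅u, v⁆ = 0)
    {x y z hy hz : L} {a b c : ℕ}
    (hex : ⁅e, x⁆ ∈ T) (hyT : hy ∈ T) (hzT : hz ∈ T) (hxy : ⁅x, y⁆ ∈ T)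
    (hey : ⁅e, hy⁆ = y) (hez : ⁅e, hz⁆ = z)
    (hx : (LieAlgebra.ad ℂ L e ^ (a + 3)) x = 0)
    (hy0 : (LieAlgebra.ad ℂ L e ^ (b + 2)) hy = 0)
    (hz0 : (LieAlgebra.ad ℂ L e ^ (c + 2)) hz = 0) :
    (LieAlgebra.ad ℂ L e ^ (a + b + c + 1)) ⁅⁅x, y⁆, z⁆ = 0 := by
  set D := LieAlgebra.ad ℂ L e with hD
  have hpow : ∀ (n : ℕ) (u : L), (D ^ n) ⁅e, u⁆ = (D ^ (n + 1)) u := fun n u => by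
    rw [pow_succ, Module.End.mul_apply, hD, LieAlgebra.ad_apply]
  have hy1 : (D ^ (b + 1)) y = 0 := by rw [← hey, hpow, hy0]
  have hz1 : (D ^ (c + 1)) z = 0 := by rw [← hez, hpow, hz0]
  have hK : (D ^ (a + b + 2)) ⁅x, y⁆ = 0 := by
    have h1 := ad_pow_lie_of_pow_succ_eq_zero e (p := a + 2) (r := b) hx hy1
    have h2 : ⁅(D ^ (a + 1)) ⁅e, x⁆, (D ^ (b + 1)) hy⁆ = 0 :=
      lie_ad_pow_eq_zero_of_lie_eq_zero e (hT _ hex _ hyT) (by rw [← hD, hpow, hx]) hy0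
    have h4 : ⁅(D ^ (a + 2)) x, (D ^ b) y⁆ = 0 := by
      rw [← hpow (a + 1), ← hey, hpow b, h2]
    rwa [← hD, show a + 2 + b = a + b + 2 by ring, h4, smul_zero] at h1
  have h3 := ad_pow_lie_of_pow_succ_eq_zero e (p := a + b + 1) (r := c) hK hz1
  have h4 : ⁅(D ^ (a + b + 1)) ⁅x, y⁆, (D ^ (c + 1)) hz⁆ = 0 :=
    lie_ad_pow_eq_zero_of_lie_eq_zero e (hT _ hxy _ hzT) hK hz0
  rw [← hpow c hz, hez] at h4
  rw [← hD, h4, smul_zero, show a + b + 1 + c = a + b + c + 1 by ring] at h3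
  exact h3

end LieGeneral

/-! ### Conjugation and the Killing form of the complexification -/

variable {g₀ : Type*} [LieRing g₀] [LieAlgebra ℝ g₀]

/-- The pure tensor `a ⊗ u` as an element of the complexification. -/
noncomputable def tens (a : ℂ) (u : g₀) : Cplx g₀ := (a ⊗ₜ[ℝ] u : ℂ ⊗[ℝ] g₀)

lemma smul_tens (z a : ℂ) (u : g₀) : z • tens a u = tens (z * a) u := rfl

lemma conj_tens (a : ℂ) (u : g₀) : conj (tens a u) = tens (starRingEnd ℂ a) u := rfl

lemma lie_tens (a b : ℂ) (u v : g₀) : ⁅tens a u, tens b v⁆ = tens (a * b) ⁅u, v⁆ := rfl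

lemma cplx_induction {p : Cplx g₀ → Prop} (zero : p 0) (tens : ∀ a u, p (tens a u))
    (add : ∀ x y, p x → p y → p (x + y)) (x : Cplx g₀) : p x :=
  TensorProduct.induction_on (motive := fun x : ℂ ⊗[ℝ] g₀ => p x) x zero tens add

lemma conj_smul (z : ℂ) (x : Cplx g₀) : conj (z • x) = (starRingEnd ℂ z) • conj x := by
  induction x using cplx_induction with
  | zero => simp only [smul_zero, map_zero]
  | tens a u => rw [smul_tens, conj_tens, conj_tens, smul_tens, map_mul]
  | add u v hu hv => simp only [smul_add, map_add, hu, hv]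

lemma conj_conj (x : Cplx g₀) : conj (conj x) = x := by
  induction x using cplx_induction with
  | zero => simp only [map_zero]
  | tens a u => rw [conj_tens, conj_tens, Complex.conj_conj]
  | add u v hu hv => simp only [map_add, hu, hv]

lemma conj_lie (x y : Cplx g₀) : conj ⁅x, y⁆ = ⁅conj x, conj y⁆ := by
  induction x using cplx_induction with
  | zero => simp only [zero_lie, map_zero]
  | add u v hu hv => simp only [add_lie, map_add, hu, hv]
  | tens a u =>
    induction y using cplx_induction with
    | zero => simp only [lie_zero, map_zero]
    | add u v hu hv => simp only [lie_add, map_add, hu, hv]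
    | tens b v => rw [lie_tens, conj_tens, conj_tens, conj_tens, lie_tens, map_mul]

lemma exists_tens_add_tens (x : Cplx g₀) : ∃ X Y : g₀, x = tens 1 X + tens Complex.I Y := by
  induction x using cplx_induction with
  | zero =>
    refine ⟨0, 0, ?_⟩
    change (0 : ℂ ⊗[ℝ] g₀) = (1 : ℂ) ⊗ₜ[ℝ] (0 : g₀) + Complex.I ⊗ₜ[ℝ] (0 : g₀)
    simp only [TensorProduct.tmul_zero, add_zero]
  | tens a u =>
    refine ⟨a.re • u, a.im • u, ?_⟩
    change a ⊗ₜ[ℝ] u = (1 : ℂ) ⊗ₜ[ℝ] (a.re • u) + Complex.I ⊗ₜ[ℝ] (a.im • u)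
    rw [← TensorProduct.smul_tmul, ← TensorProduct.smul_tmul, ← TensorProduct.add_tmul,
      Complex.real_smul, Complex.real_smul, mul_one, Complex.re_add_im]
  | add u v hu hv =>
    obtain ⟨X, Y, rfl⟩ := hu
    obtain ⟨X', Y', rfl⟩ := hv
    refine ⟨X + X', Y + Y', ?_⟩
    have h1 (a : ℂ) (u v : g₀) : tens a (u + v) = tens a u + tens a v :=
      TensorProduct.tmul_add a u v
    rw [h1, h1]
    abel

lemma killingForm_tens [FiniteDimensional ℝ g₀] (a b : ℂ) (u v : g₀) :
    killingForm ℂ (Cplx g₀) (tens a u) (tens b v) = killingForm ℝ g₀ u v * (a * b) := by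
  have h := congrArg (fun B => B (tens a u : ℂ ⊗[ℝ] g₀) (tens b v : ℂ ⊗[ℝ] g₀))
    (LieModule.traceForm_baseChange ℝ g₀ g₀ ℂ)
  refine h.trans ?_
  refine (LinearMap.BilinForm.baseChange_tmul (A := ℂ) _ a u b v).trans ?_
  rw [Complex.real_smul]

lemma isKilling_cplx [FiniteDimensional ℝ g₀] (hg₀ : IsCompactSemisimple g₀) :
    LieAlgebra.IsKilling ℂ (Cplx g₀) := by
  have hzero : ∀ X : g₀, killingForm ℝ g₀ X X = 0 → X = 0 := fun X hX => by
    by_contra hne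
    exact (hg₀ X hne).ne hX
  refine ⟨(LieSubmodule.eq_bot_iff _).mpr fun x hx => ?_⟩
  obtain ⟨X, Y, rfl⟩ := exists_tens_add_tens x
  -- pairing with a real vector separates the real and imaginary parts
  have hpair (Z : g₀) : (killingForm ℝ g₀ X Z : ℂ) + killingForm ℝ g₀ Y Z * Complex.I = 0 := by
    have h1 := (LieIdeal.mem_killingCompl ℂ (Cplx g₀) ⊤).mp hx (tens 1 Z) trivial
    rw [LieModule.traceForm_comm, map_add, LinearMap.add_apply] at h1
    erw [killingForm_tens, killingForm_tens] at h1
    simpa using h1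
  have hX : X = 0 := hzero X (by simpa using congrArg Complex.re (hpair X))
  have hY : Y = 0 := hzero Y (by simpa using congrArg Complex.im (hpair Y))
  rw [hX, hY]
  change (1 : ℂ) ⊗ₜ[ℝ] (0 : g₀) + Complex.I ⊗ₜ[ℝ] (0 : g₀) = (0 : ℂ ⊗[ℝ] g₀)
  simp only [TensorProduct.tmul_zero, add_zero]

/-! ### The zero eigenspace of a regular element -/

/-- Since `W₀` is regular, the sum of the nonzero root spaces meets the zero eigenspace `V 0` of
`ad W₀` trivially, so `V 0` is contained in the Cartan subalgebra, which is abelian. -/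
lemma lie_eq_zero_of_mem_V_zero [FiniteDimensional ℝ g₀] (hg₀ : IsCompactSemisimple g₀)
    {h : LieSubalgebra ℂ (Cplx g₀)} [h.IsCartanSubalgebra] {W₀ : Cplx g₀}
    (hW₀ : IsRegularIn h W₀) {x y : Cplx g₀} (hx : x ∈ V W₀ 0) (hy : y ∈ V W₀ 0) :
    ⁅x, y⁆ = 0 := by
  have := isKilling_cplx hg₀
  obtain ⟨hW, hreg⟩ := hW₀
  suffices key : ∀ u ∈ V W₀ 0, u ∈ h by
    have := congrArg Subtype.val (trivial_lie_zero h h ⟨x, key x hx⟩ ⟨y, key y hy⟩)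
    simpa using this
  intro u hu
  set A := LieAlgebra.ad ℂ (Cplx g₀) W₀
  have htop : (⊤ : Submodule ℂ (Cplx g₀)) ≤
      h.toSubmodule ⊔ ⨆ μ : ℂ, ⨆ _ : μ ≠ 0, A.eigenspace μ := by
    have h1 := LieModule.iSup_genWeightSpace_eq_top' ℂ h (Cplx g₀)
    rw [← LieSubmodule.toSubmodule_inj, LieSubmodule.iSup_toSubmodule,
      LieSubmodule.top_toSubmodule] at h1
    rw [← h1]
    refine iSup_le fun χ => ?_
    by_cases hχ : χ.IsZero
    · refine le_sup_of_le_left ?_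
      have hχ' : (χ : h → ℂ) = 0 := hχ
      rw [hχ']
      exact (congrArg LieSubmodule.toSubmodule (LieAlgebra.rootSpace_zero_eq ℂ _ h)).le
    · refine le_sup_of_le_right (le_iSup₂_of_le (χ ⟨W₀, hW⟩) (hreg χ hχ) ?_)
      intro v hv
      rw [Module.End.mem_eigenspace_iff]
      exact LieAlgebra.IsKilling.lie_eq_smul_of_mem_rootSpace hv ⟨W₀, hW⟩
  obtain ⟨a, ha, b, hb, rfl⟩ := Submodule.mem_sup.mp (htop (Submodule.mem_top (x := u)))
  have hb0 : b ∈ A.eigenspace 0 := by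
    have ha0 : ⁅W₀, a⁆ = 0 := by
      simpa using congrArg Subtype.val (trivial_lie_zero h h ⟨W₀, hW⟩ ⟨a, ha⟩)
    rw [V, Module.End.mem_eigenspace_iff] at hu
    rw [Module.End.mem_eigenspace_iff]
    simpa [A, ha0] using hu
  have := (Submodule.disjoint_def.mp (Module.End.eigenspaces_iSupIndep A 0)) b hb0 hb
  rw [this, add_zero]
  exact ha

/-! ### Eigenspaces of `ad W₀` -/

variable {W₀ Ωp Ωm : Cplx g₀}

lemma mem_V_iff {n : ℤ} {x : Cplx g₀} : x ∈ V W₀ n ↔ ⁅W₀, x⁆ = (n : ℂ) • x := by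
  rw [V, Module.End.mem_eigenspace_iff, LieAlgebra.ad_apply]

lemma lie_mem_V {m n : ℤ} {x y : Cplx g₀} (hx : x ∈ V W₀ m) (hy : y ∈ V W₀ n) :
    ⁅x, y⁆ ∈ V W₀ (m + n) := by
  rw [mem_V_iff] at *
  rw [leibniz_lie, hx, hy, smul_lie, lie_smul, Int.cast_add, add_smul]

lemma real_smul_eq (r : ℝ) (x : Cplx g₀) : r • x = (r : ℂ) • x :=
  (algebraMap_smul ℂ r x).symm

namespace IsCompactTriple

lemma Ωp_mem (hΩ : IsCompactTriple W₀ Ωp Ωm) : Ωp ∈ V W₀ 2 := by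
  rw [mem_V_iff, hΩ.lie_W₀_Ωp]; norm_num

lemma Ωm_mem (hΩ : IsCompactTriple W₀ Ωp Ωm) : Ωm ∈ V W₀ (-2) := by
  rw [mem_V_iff, hΩ.lie_W₀_Ωm]; norm_num

lemma conj_Ωm (hΩ : IsCompactTriple W₀ Ωp Ωm) : conj Ωm = -Ωp := by
  rw [← conj_conj Ωp, hΩ.conj_Ωp, map_neg, neg_neg]

lemma conj_W₀ (hΩ : IsCompactTriple W₀ Ωp Ωm) : conj W₀ = -W₀ := by
  rw [← hΩ.lie_Ωp_Ωm, conj_lie, hΩ.conj_Ωp, hΩ.conj_Ωm, neg_lie, lie_neg, neg_neg, lie_skew]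

lemma conj_mem_V (hΩ : IsCompactTriple W₀ Ωp Ωm) {n : ℤ} {x : Cplx g₀} (hx : x ∈ V W₀ n) :
    conj x ∈ V W₀ (-n) := by
  rw [mem_V_iff] at *
  have h := congrArg conj hx
  rw [conj_lie, hΩ.conj_W₀, conj_smul, neg_lie, map_intCast] at h
  rw [← neg_neg ⁅W₀, conj x⁆, h, Int.cast_neg, neg_smul]

lemma ad_pow_mem_V (hΩ : IsCompactTriple W₀ Ωp Ωm) {n : ℤ} {x : Cplx g₀} (hx : x ∈ V W₀ n)
    (m : ℕ) : (LieAlgebra.ad ℂ (Cplx g₀) Ωp ^ m) x ∈ V W₀ (n + 2 * m) := by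
  induction m with
  | zero => simpa using hx
  | succ m ih =>
    rw [pow_succ', Module.End.mul_apply, LieAlgebra.ad_apply]
    have := lie_mem_V hΩ.Ωp_mem ih
    convert this using 2
    push_cast; ring

end IsCompactTriple

/-! ### Ladders of highest weight vectors -/

lemma ladder_zero (ξ : Cplx g₀) : ladder Ωm 0 ξ = ξ := by
  simp [ladder]

lemma ladder_add (l : ℕ) (ξ η : Cplx g₀) : ladder Ωm l (ξ + η) = ladder Ωm l ξ + ladder Ωm l η := by
  simp [ladder]

lemma ladder_smul (l : ℕ) (z : ℂ) (ξ : Cplx g₀) : ladder Ωm l (z • ξ) = z • ladder Ωm l ξ := by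
  rw [ladder, map_smul, smul_comm, ladder]

lemma lie_ladder (l : ℕ) (ξ : Cplx g₀) :
    ⁅Ωm, ladder Ωm l ξ⁆ = ((l : ℂ) + 1) • ladder Ωm (l + 1) ξ := by
  have hl : (l : ℂ) + 1 ≠ 0 := by exact_mod_cast l.succ_ne_zero
  have hf : (l.factorial : ℂ) ≠ 0 := by exact_mod_cast l.factorial_ne_zero
  rw [ladder, ladder, lie_smul, smul_smul, pow_succ', Module.End.mul_apply, LieAlgebra.ad_apply,
    Nat.factorial_succ]
  congr 1
  push_cast
  field_simp

lemma ladder_succ (l : ℕ) (ξ : Cplx g₀) :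
    ladder Ωm (l + 1) ξ = ((l : ℂ) + 1)⁻¹ • ⁅Ωm, ladder Ωm l ξ⁆ := by
  have hl : (l : ℂ) + 1 ≠ 0 := by exact_mod_cast l.succ_ne_zero
  rw [lie_ladder, smul_smul, inv_mul_cancel₀ hl, one_smul]

lemma ladder_mem_V (hΩ : IsCompactTriple W₀ Ωp Ωm) {n : ℤ} {ξ : Cplx g₀} (hξ : ξ ∈ V W₀ n)
    (l : ℕ) : ladder Ωm l ξ ∈ V W₀ (n - 2 * l) := by
  induction l with
  | zero => simpa [ladder_zero] using hξ
  | succ l ih =>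
    rw [ladder_succ]
    refine Submodule.smul_mem _ _ ?_
    convert lie_mem_V hΩ.Ωm_mem ih using 2
    push_cast; ring

lemma lie_Ωp_ladder_succ (hΩ : IsCompactTriple W₀ Ωp Ωm) {k : ℕ} {ξ : Cplx g₀}
    (hξ : IsHighest W₀ Ωp k ξ) (l : ℕ) :
    ⁅Ωp, ladder Ωm (l + 1) ξ⁆ = (2 * k - l : ℂ) • ladder Ωm l ξ := by
  have hW (l : ℕ) := mem_V_iff.mp (ladder_mem_V hΩ hξ.1 l)
  induction l with
  | zero =>
    rw [ladder_succ, lie_smul, leibniz_lie, hΩ.lie_Ωp_Ωm, hW, ladder_zero, hξ.2]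
    simp
  | succ l ih =>
    have hl : (l : ℂ) + 1 + 1 ≠ 0 := by exact_mod_cast (l + 1).succ_ne_zero
    rw [ladder_succ, lie_smul, leibniz_lie, hΩ.lie_Ωp_Ωm, hW, ih, lie_smul, lie_ladder, smul_smul,
      ← add_smul, smul_smul]
    congr 1
    push_cast
    field_simp
    ring

/-- Raising a ladder vector `n` times; beyond the top of the ladder see
`ad_pow_ladder_eq_zero`. -/
lemma ad_pow_ladder (hΩ : IsCompactTriple W₀ Ωp Ωm) {k : ℕ} {ξ : Cplx g₀}
    (hξ : IsHighest W₀ Ωp k ξ) {m n : ℕ} (hmn : m + n ≤ 2 * k) :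
    (LieAlgebra.ad ℂ (Cplx g₀) Ωp ^ n) (ladder Ωm (m + n) ξ) =
      ((2 * k - m).descFactorial n : ℂ) • ladder Ωm m ξ := by
  induction n with
  | zero => simp
  | succ n ih =>
    rw [pow_succ, Module.End.mul_apply, LieAlgebra.ad_apply, ← add_assoc,
      lie_Ωp_ladder_succ hΩ hξ, map_smul, ih (by omega), smul_smul, Nat.descFactorial_succ]
    congr 1
    rw [Nat.cast_mul, Nat.sub_sub, Nat.cast_sub (by omega)]
    push_cast
    ring

lemma ad_pow_ladder_eq_zero (hΩ : IsCompactTriple W₀ Ωp Ωm) {k : ℕ} {ξ : Cplx g₀}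
    (hξ : IsHighest W₀ Ωp k ξ) {m n : ℕ} (hmk : m ≤ 2 * k) (hmn : m < n) :
    (LieAlgebra.ad ℂ (Cplx g₀) Ωp ^ n) (ladder Ωm m ξ) = 0 := by
  refine Module.End.pow_map_zero_of_le (show m + 1 ≤ n from hmn) ?_
  have := ad_pow_ladder hΩ hξ (m := 0) (n := m) (by omega)
  rw [zero_add, ladder_zero] at this
  rw [pow_succ', Module.End.mul_apply, this, map_smul, LieAlgebra.ad_apply, hξ.2, smul_zero]

lemma ladder_eq_zero [FiniteDimensional ℝ g₀] (hΩ : IsCompactTriple W₀ Ωp Ωm) (hW : W₀ ≠ 0)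
    {k : ℕ} {ξ : Cplx g₀} (hξ : IsHighest W₀ Ωp k ξ) : ladder Ωm (2 * k + 1) ξ = 0 := by
  by_cases h0 : ξ = 0
  · simp [h0, ladder]
  have t : IsSl2Triple W₀ Ωp Ωm :=
    ⟨hW, hΩ.lie_Ωp_Ωm, by rw [hΩ.lie_W₀_Ωp, two_smul, two_smul],
      by rw [hΩ.lie_W₀_Ωm, two_smul, two_smul]⟩
  have hp : t.HasPrimitiveVectorWith ξ ((2 * k : ℕ) : ℂ) :=
    ⟨h0, by have := mem_V_iff.mp hξ.1; push_cast at this ⊢; exact this, hξ.2⟩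
  have := hp.pow_toEnd_f_eq_zero_of_eq_nat rfl
  rw [ladder]
  erw [this]
  rw [smul_zero]

/-! ### Adapted highest weight vectors -/

lemma conj_ladder (hΩ : IsCompactTriple W₀ Ωp Ωm) (l : ℕ) (ξ : Cplx g₀) :
    conj (ladder Ωm l ξ) = ((-1 : ℂ) ^ l * (l.factorial : ℂ)⁻¹) •
      (LieAlgebra.ad ℂ (Cplx g₀) Ωp ^ l) (conj ξ) := by
  induction l with
  | zero => simp [ladder_zero]
  | succ l ih =>
    rw [ladder_succ, conj_smul, conj_lie, ih, hΩ.conj_Ωm, neg_lie, lie_smul, ← smul_neg,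
      pow_succ' (LieAlgebra.ad ℂ (Cplx g₀) Ωp), Module.End.mul_apply, LieAlgebra.ad_apply,
      smul_neg, ← neg_smul, smul_smul, Nat.factorial_succ]
    congr 1
    simp only [map_inv₀, map_add, map_natCast, map_one, Nat.cast_mul, Nat.cast_add, Nat.cast_one,
      mul_inv]
    ring

/-- The relation at the top of the ladder implies the relations at all of its steps. -/
lemma IsHighest.isAdapted (hΩ : IsCompactTriple W₀ Ωp Ωm) {k : ℕ} {ξ : Cplx g₀}
    (hξ : IsHighest W₀ Ωp k ξ) (hc : conj ξ = ladder Ωm (2 * k) ξ) :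
    IsAdapted W₀ Ωp Ωm k ξ := by
  refine ⟨hξ, fun l hl => ?_⟩
  have h := ad_pow_ladder hΩ hξ (m := 2 * k - l) (n := l) (by omega)
  rw [Nat.sub_add_cancel hl, Nat.sub_sub_self hl, Nat.descFactorial_self] at h
  rw [conj_ladder hΩ, hc, h, smul_smul, mul_assoc, inv_mul_cancel₀, mul_one]
  exact_mod_cast l.factorial_ne_zero

lemma IsHighest.conj_ladder [FiniteDimensional ℝ g₀] (hΩ : IsCompactTriple W₀ Ωp Ωm)
    (hW : W₀ ≠ 0) {k : ℕ} {ξ : Cplx g₀} (hξ : IsHighest W₀ Ωp k ξ) :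
    IsHighest W₀ Ωp k (conj (ladder Ωm (2 * k) ξ)) := by
  refine ⟨?_, ?_⟩
  · convert hΩ.conj_mem_V (ladder_mem_V hΩ hξ.1 (2 * k)) using 2
    push_cast; ring
  · rw [← neg_neg Ωp, ← hΩ.conj_Ωm, neg_lie, ← conj_lie, lie_ladder, ladder_eq_zero hΩ hW hξ,
      smul_zero, map_zero, neg_zero]

lemma conj_ladder_conj_ladder (hΩ : IsCompactTriple W₀ Ωp Ωm) {k : ℕ} {ξ : Cplx g₀}
    (hξ : IsHighest W₀ Ωp k ξ) :
    conj (ladder Ωm (2 * k) (conj (ladder Ωm (2 * k) ξ))) = ξ := by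
  have h := ad_pow_ladder hΩ hξ (m := 0) (n := 2 * k) (by omega)
  rw [zero_add, ladder_zero, Nat.sub_zero, Nat.descFactorial_self] at h
  rw [conj_ladder hΩ, conj_conj, h, smul_smul, mul_assoc, inv_mul_cancel₀, mul_one,
    Even.neg_one_pow (even_two_mul k), one_smul]
  exact_mod_cast (2 * k).factorial_ne_zero

/-- The antilinear involution `ξ ↦ c(ξ_{2k})` is a real structure on the space of highest weight
vectors, and its fixed points are the adapted vectors. -/
lemma IsHighest.exists_isAdapted [FiniteDimensional ℝ g₀] (hΩ : IsCompactTriple W₀ Ωp Ωm)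
    (hW : W₀ ≠ 0) {k : ℕ} {ξ : Cplx g₀} (hξ : IsHighest W₀ Ωp k ξ) :
    ∃ ξ₁ ξ₂, IsAdapted W₀ Ωp Ωm k ξ₁ ∧ IsAdapted W₀ Ωp Ωm k ξ₂ ∧
      ξ = ξ₁ + Complex.I • ξ₂ := by
  set η := conj (ladder Ωm (2 * k) ξ) with hη
  have hη' : IsHighest W₀ Ωp k η := hξ.conj_ladder hΩ hW
  have hξη : conj ξ = ladder Ωm (2 * k) η := by
    rw [← conj_conj (ladder Ωm (2 * k) η), hη, conj_ladder_conj_ladder hΩ hξ]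
  have hηξ : conj η = ladder Ωm (2 * k) ξ := by rw [hη, conj_conj]
  have hcomb (z w : ℂ) (hzw : starRingEnd ℂ z = w) :
      IsAdapted W₀ Ωp Ωm k (z • ξ + w • η) := by
    refine IsHighest.isAdapted hΩ ⟨?_, ?_⟩ ?_
    · exact add_mem (Submodule.smul_mem _ _ hξ.1) (Submodule.smul_mem _ _ hη'.1)
    · rw [lie_add, lie_smul, lie_smul, hξ.2, hη'.2, smul_zero, smul_zero, add_zero]
    · rw [map_add, conj_smul, conj_smul, hξη, hηξ, ladder_add, ladder_smul, ladder_smul, ← hzw,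
        Complex.conj_conj, add_comm]
  refine ⟨_, _, hcomb (1 / 2) (1 / 2) (by simp [map_ofNat]),
    hcomb (-Complex.I / 2) (Complex.I / 2) (by simp [map_ofNat]), ?_⟩
  rw [smul_add, smul_smul, smul_smul, add_add_add_comm, ← add_smul, ← add_smul]
  have h1 : (1 / 2 : ℂ) + Complex.I * (-Complex.I / 2) = 1 := by
    linear_combination (-1 / 2) * Complex.I_mul_I
  have h2 : (1 / 2 : ℂ) + Complex.I * (Complex.I / 2) = 0 := by
    linear_combination (1 / 2) * Complex.I_mul_I
  rw [h1, h2, one_smul, zero_smul, add_zero]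

lemma phase_ne_zero (k : ℕ) : phase k ≠ 0 := by
  rw [phase]; split_ifs <;> simp

lemma smul_mem_EZero_sup_EPlus {l : ℕ} {ξ : Cplx g₀}
    (hξ : IsAdapted W₀ Ωp Ωm (kappa W₀ Ωp l) ξ) (z : ℂ) :
    z • ladder Ωm (kappa W₀ Ωp l - 1) ξ ∈ EZero W₀ Ωp Ωm l ⊔ EPlus W₀ Ωp Ωm l := by
  set X := phase (kappa W₀ Ωp l) • ladder Ωm (kappa W₀ Ωp l - 1) ξ with hX
  set w : ℂ := z * (phase (kappa W₀ Ωp l))⁻¹ with hw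
  have h1 : z • ladder Ωm (kappa W₀ Ωp l - 1) ξ = w.im • (Complex.I • X) + w.re • X := by
    rw [real_smul_eq, real_smul_eq, smul_smul, ← add_smul, add_comm ((w.im : ℂ) * _),
      Complex.re_add_im, hX, smul_smul, hw, mul_assoc, inv_mul_cancel₀ (phase_ne_zero _), mul_one]
  rw [h1]
  exact Submodule.add_mem_sup (Submodule.smul_mem _ _ (Submodule.subset_span ⟨ξ, hξ, rfl⟩))
    (Submodule.smul_mem _ _ (Submodule.subset_span ⟨ξ, hξ, rfl⟩))

lemma IsHighest.ladder_mem_EZero_sup_EPlus [FiniteDimensional ℝ g₀]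
    (hΩ : IsCompactTriple W₀ Ωp Ωm) (hW : W₀ ≠ 0) {l : ℕ} {ξ : Cplx g₀}
    (hξ : IsHighest W₀ Ωp (kappa W₀ Ωp l) ξ) (z : ℂ) :
    z • ladder Ωm (kappa W₀ Ωp l - 1) ξ ∈ EZero W₀ Ωp Ωm l ⊔ EPlus W₀ Ωp Ωm l := by
  obtain ⟨ξ₁, ξ₂, h₁, h₂, rfl⟩ := hξ.exists_isAdapted hΩ hW
  rw [ladder_add, ladder_smul, smul_add, smul_smul]
  exact add_mem (smul_mem_EZero_sup_EPlus h₁ _) (smul_mem_EZero_sup_EPlus h₂ _)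

/-! ### The distinct weights and the index `ñ` -/

lemma finite_weightSet [FiniteDimensional ℝ g₀] : (weightSet W₀ Ωp).Finite := by
  have hfin := (LieAlgebra.ad ℂ (Cplx g₀) W₀).finite_hasEigenvalue
  refine (hfin.preimage (f := fun k : ℕ => (((2 * k : ℤ)) : ℂ)) ?_).subset ?_
  · intro a _ b _ hab
    have : (2 * a : ℤ) = 2 * b := Int.cast_injective (α := ℂ) hab
    omega
  · rintro k ⟨-, ξ, hne, hξ⟩
    exact Module.End.hasEigenvalue_of_hasEigenvector ⟨hξ.1, hne⟩

lemma kappa_mem_weightSet {l : ℕ} (h1 : 1 ≤ l) (hl : l ≤ numWeights W₀ Ωp) :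
    kappa W₀ Ωp l ∈ weightSet W₀ Ωp := by
  refine Nat.nth_mem (p := fun k => k ∈ weightSet W₀ Ωp) (l - 1) fun hf => ?_
  have : numWeights W₀ Ωp = hf.toFinset.card := Set.ncard_eq_toFinset_card _ hf
  omega

lemma kappa_le_kappa {l m : ℕ} (hlm : l ≤ m) (h1 : 1 ≤ m) (hm : m ≤ numWeights W₀ Ωp) :
    kappa W₀ Ωp l ≤ kappa W₀ Ωp m := by
  refine Nat.nth_le_nth' (p := fun k => k ∈ weightSet W₀ Ωp) (Nat.sub_le_sub_right hlm 1)
    fun hf => ?_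
  have : numWeights W₀ Ωp = hf.toFinset.card := Set.ncard_eq_toFinset_card _ hf
  omega

lemma exists_kappa_eq [FiniteDimensional ℝ g₀] {k : ℕ} (hk : k ∈ weightSet W₀ Ωp) :
    ∃ l, 1 ≤ l ∧ l ≤ numWeights W₀ Ωp ∧ kappa W₀ Ωp l = k := by
  have hf : (weightSet W₀ Ωp).Finite := finite_weightSet
  obtain ⟨n, hn, hnk⟩ :=
    Nat.exists_lt_card_finite_nth_eq (p := fun k => k ∈ weightSet W₀ Ωp) hf hk
  have : numWeights W₀ Ωp = hf.toFinset.card := Set.ncard_eq_toFinset_card _ hf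
  refine ⟨n + 1, by omega, ?_, hnk⟩
  rw [this]
  exact hn

lemma le_tilde {n l : ℕ} (hn : n ≠ 0) (h1 : 1 ≤ l) (hl : l ≤ numWeights W₀ Ωp)
    (hk : kappa W₀ Ωp l ≤ n) : l ≤ tilde W₀ Ωp n := by
  rw [tilde, if_neg hn]
  exact Finset.le_sup (f := id) (Finset.mem_filter.mpr ⟨Finset.mem_Icc.mpr ⟨h1, hl⟩, hk⟩)

lemma kappa_le_of_le_tilde {n l : ℕ} (hn : n ≠ 0) (h1 : 1 ≤ l) (hl : l ≤ tilde W₀ Ωp n) :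
    l ≤ numWeights W₀ Ωp ∧ kappa W₀ Ωp l ≤ n := by
  rw [tilde, if_neg hn] at hl
  set S := (Finset.Icc 1 (numWeights W₀ Ωp)).filter (fun l => kappa W₀ Ωp l ≤ n)
  have hS : S.Nonempty := by
    rw [Finset.nonempty_iff_ne_empty]
    intro h0
    rw [h0] at hl
    simp at hl
    omega
  obtain ⟨m, hm, hsup⟩ := Finset.exists_mem_eq_sup S hS id
  rw [hsup, id] at hl
  obtain ⟨hm1, hm2⟩ := Finset.mem_filter.mp hm
  rw [Finset.mem_Icc] at hm1
  exact ⟨hl.trans hm1.2, (kappa_le_kappa hl hm1.1 hm1.2).trans hm2⟩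

lemma ne_zero_of_one_le_kappa [FiniteDimensional ℝ g₀]
    (h : 1 ≤ kappa W₀ Ωp (numWeights W₀ Ωp) - 1) : W₀ ≠ 0 := by
  rintro rfl
  have hmem : kappa 0 Ωp (numWeights 0 Ωp) ∈ weightSet 0 Ωp :=
    Nat.nth_mem_of_ne_zero (p := fun k => k ∈ weightSet 0 Ωp) (by rw [kappa] at h; omega)
  obtain ⟨h1, ξ, hne, hξ, -⟩ := hmem
  rw [mem_V_iff, zero_lie, eq_comm, smul_eq_zero] at hξ
  rcases hξ with h0 | h0
  · have : (2 * kappa (0 : Cplx g₀) Ωp (numWeights 0 Ωp) : ℤ) = 0 := by exact_mod_cast h0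
    omega
  · exact hne h0

/-- `Ω₊` itself is a highest weight vector of weight `2`, so the smallest weight is `κ₁ = 1`. -/
lemma one_mem_weightSet (hΩ : IsCompactTriple W₀ Ωp Ωm) (hW : W₀ ≠ 0) : 1 ∈ weightSet W₀ Ωp := by
  refine ⟨le_rfl, Ωp, ?_, ?_, lie_self Ωp⟩
  · rintro rfl
    exact hW (by rw [← hΩ.lie_Ωp_Ωm, zero_lie])
  · simpa using hΩ.Ωp_mem

lemma kappa_one [FiniteDimensional ℝ g₀] (hΩ : IsCompactTriple W₀ Ωp Ωm) (hW : W₀ ≠ 0) :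
    1 ≤ numWeights W₀ Ωp ∧ kappa W₀ Ωp 1 = 1 := by
  obtain ⟨l, h1, hl, hk⟩ := exists_kappa_eq (one_mem_weightSet hΩ hW)
  refine ⟨h1.trans hl, le_antisymm ?_ (kappa_mem_weightSet le_rfl (h1.trans hl)).1⟩
  exact (kappa_le_kappa h1 h1 hl).trans hk.le

/-- The indices `q ≤ ñ` only involve weights `κ_q ≤ max n 1`. -/
lemma kappa_le_max_of_le_tilde [FiniteDimensional ℝ g₀] (hΩ : IsCompactTriple W₀ Ωp Ωm)
    (hW : W₀ ≠ 0) {n q : ℕ} (h1 : 1 ≤ q) (hq : q ≤ tilde W₀ Ωp n) :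
    q ≤ numWeights W₀ Ωp ∧ kappa W₀ Ωp q ≤ max n 1 := by
  by_cases hn : n = 0
  · subst hn
    rw [tilde, if_pos rfl] at hq
    obtain rfl : q = 1 := by omega
    exact ⟨(kappa_one hΩ hW).1, (kappa_one hΩ hW).2.le⟩
  · obtain ⟨h2, h3⟩ := kappa_le_of_le_tilde hn h1 hq
    exact ⟨h2, h3.trans (le_max_left _ _)⟩

/-! ### Levels of vectors in `V 2` -/

/-- The vectors of `V 2` of level at most `n + 1`, i.e. coming from the highest weights `2k` with
`k ≤ n + 1`. The level is expressed by the order of vanishing under `ad Ω₊` of a primitive of the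
vector in `V 0` and of its conjugate in `V (-2)`, which are the data that enter the estimate of
triple brackets. The index is the level minus one, so that the indices of the three factors add up
in `lie_lie_mem_filt`. -/
def levelSpace (W₀ Ωp : Cplx g₀) (n : ℕ) : Submodule ℂ (Cplx g₀) where
  carrier := {Z | (∃ H ∈ V W₀ 0, ⁅Ωp, H⁆ = Z ∧ (LieAlgebra.ad ℂ (Cplx g₀) Ωp ^ (n + 2)) H = 0) ∧
    conj Z ∈ V W₀ (-2) ∧ (LieAlgebra.ad ℂ (Cplx g₀) Ωp ^ (n + 3)) (conj Z) = 0}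
  zero_mem' := ⟨⟨0, zero_mem _, lie_zero _, map_zero _⟩, by rw [map_zero]; exact zero_mem _,
    by rw [map_zero, map_zero]⟩
  add_mem' := by
    rintro x y ⟨⟨H, hH, hx, hH0⟩, hx2, hx3⟩ ⟨⟨K, hK, hy, hK0⟩, hy2, hy3⟩
    refine ⟨⟨H + K, add_mem hH hK, by rw [lie_add, hx, hy], by rw [map_add, hH0, hK0, add_zero]⟩,
      by rw [map_add]; exact add_mem hx2 hy2, by rw [map_add, map_add, hx3, hy3, add_zero]⟩
  smul_mem' := by
    rintro z x ⟨⟨H, hH, hx, hH0⟩, hx2, hx3⟩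
    refine ⟨⟨z • H, Submodule.smul_mem _ _ hH, by rw [lie_smul, hx],
      by rw [map_smul, hH0, smul_zero]⟩,
      by rw [conj_smul]; exact Submodule.smul_mem _ _ hx2,
      by rw [conj_smul, map_smul, hx3, smul_zero]⟩

lemma mem_V_of_mem_levelSpace (hΩ : IsCompactTriple W₀ Ωp Ωm) {n : ℕ} {Z : Cplx g₀}
    (hZ : Z ∈ levelSpace W₀ Ωp n) : Z ∈ V W₀ 2 := by
  obtain ⟨⟨H, hH, rfl, -⟩, -⟩ := hZ
  simpa using lie_mem_V hΩ.Ωp_mem hH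

lemma IsAdapted.ladder_mem_levelSpace (hΩ : IsCompactTriple W₀ Ωp Ωm) {k n : ℕ} {ξ : Cplx g₀}
    (hξ : IsAdapted W₀ Ωp Ωm k ξ) (hk : 1 ≤ k) (hkn : k ≤ n + 1) :
    ladder Ωm (k - 1) ξ ∈ levelSpace W₀ Ωp n := by
  obtain ⟨hξ, hc⟩ := hξ
  obtain ⟨j, rfl⟩ : ∃ j, k = j + 1 := ⟨k - 1, by omega⟩
  have hconj := hc j (by omega)
  rw [show 2 * (j + 1) - j = j + 2 by omega] at hconj
  rw [Nat.add_sub_cancel]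
  refine ⟨⟨((j : ℂ) + 2)⁻¹ • ladder Ωm (j + 1) ξ, ?_, ?_, ?_⟩, ?_, ?_⟩
  · refine Submodule.smul_mem _ _ ?_
    have := ladder_mem_V hΩ hξ.1 (j + 1)
    rwa [sub_self] at this
  · have hj : (j : ℂ) + 2 ≠ 0 := by exact_mod_cast (j + 1).succ_ne_zero
    rw [lie_smul, lie_Ωp_ladder_succ hΩ hξ, smul_smul]
    convert one_smul ℂ (ladder Ωm j ξ) using 2
    push_cast
    field_simp
    ring
  · rw [map_smul, ad_pow_ladder_eq_zero hΩ hξ (by omega) (by omega), smul_zero]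
  · rw [hconj]
    refine Submodule.smul_mem _ _ ?_
    convert ladder_mem_V hΩ hξ.1 (j + 2) using 2
    push_cast; ring
  · rw [hconj, map_smul, ad_pow_ladder_eq_zero hΩ hξ (by omega) (by omega), smul_zero]

lemma EZero_sup_EPlus_le_levelSpace (hΩ : IsCompactTriple W₀ Ωp Ωm) {q n : ℕ}
    (h1 : 1 ≤ kappa W₀ Ωp q) (hn : kappa W₀ Ωp q ≤ n + 1) :
    EZero W₀ Ωp Ωm q ⊔ EPlus W₀ Ωp Ωm q ≤ (levelSpace W₀ Ωp n).restrictScalars ℝ := by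
  refine sup_le (Submodule.span_le.mpr ?_) (Submodule.span_le.mpr ?_)
  · rintro _ ⟨ξ, hξ, rfl⟩
    have h := Submodule.smul_mem _ (phase (kappa W₀ Ωp q)) (hξ.ladder_mem_levelSpace hΩ h1 hn)
    exact (levelSpace W₀ Ωp n).smul_mem Complex.I h
  · rintro _ ⟨ξ, hξ, rfl⟩
    exact (levelSpace W₀ Ωp n).smul_mem _ (hξ.ladder_mem_levelSpace hΩ h1 hn)

lemma filt_tilde_le_levelSpace [FiniteDimensional ℝ g₀] (hΩ : IsCompactTriple W₀ Ωp Ωm)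
    (hW : W₀ ≠ 0) (n : ℕ) :
    filt W₀ Ωp Ωm (tilde W₀ Ωp n) ≤ (levelSpace W₀ Ωp (n - 1)).restrictScalars ℝ := by
  refine iSup₂_le fun q hq => ?_
  rw [Finset.mem_Icc] at hq
  obtain ⟨h1, h2⟩ := kappa_le_max_of_le_tilde hΩ hW hq.1 hq.2
  exact EZero_sup_EPlus_le_levelSpace hΩ (kappa_mem_weightSet hq.1 h1).1 (by omega)

/-- A vector of `V 2` killed by `(ad Ω₊)ⁿ` has only components of highest weight `2k` with
`k ≤ n`: the highest weight vector `(ad Ω₊)ⁿ⁻¹ Z` determines the top component, which can be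
subtracted. -/
lemma mem_filt_of_ad_pow_eq_zero [FiniteDimensional ℝ g₀] (hΩ : IsCompactTriple W₀ Ωp Ωm)
    (hW : W₀ ≠ 0) {s : ℕ} (hs : s ≠ 0) {n : ℕ} (hns : n ≤ s) {Z : Cplx g₀} (hZ : Z ∈ V W₀ 2)
    (hZ0 : (LieAlgebra.ad ℂ (Cplx g₀) Ωp ^ n) Z = 0) :
    Z ∈ filt W₀ Ωp Ωm (tilde W₀ Ωp s) := by
  induction n generalizing Z with
  | zero =>
    rw [pow_zero, Module.End.one_apply] at hZ0
    rw [hZ0]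
    exact zero_mem _
  | succ n ih =>
    set D := LieAlgebra.ad ℂ (Cplx g₀) Ωp with hD
    set ξ := (D ^ n) Z with hξdef
    have hξ : IsHighest W₀ Ωp (n + 1) ξ := by
      refine ⟨?_, ?_⟩
      · convert hΩ.ad_pow_mem_V hZ n using 2
        push_cast; ring
      · rw [pow_succ', Module.End.mul_apply] at hZ0
        exact hZ0
    set d : ℂ := ((2 * (n + 1)).descFactorial n : ℂ) with hd
    have hd0 : d ≠ 0 := by
      rw [hd, Nat.cast_ne_zero, Ne, Nat.descFactorial_eq_zero_iff_lt]
      omega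
    have hDl : (D ^ n) (ladder Ωm n ξ) = d • ξ := by
      have := ad_pow_ladder hΩ hξ (m := 0) (n := n) (by omega)
      rwa [zero_add, ladder_zero, Nat.sub_zero] at this
    have hlad : d⁻¹ • ladder Ωm n ξ ∈ filt W₀ Ωp Ωm (tilde W₀ Ωp s) := by
      by_cases h0 : ξ = 0
      · simp [h0, ladder]
      obtain ⟨q, hq1, hq2, hq⟩ := exists_kappa_eq (W₀ := W₀) (Ωp := Ωp) (k := n + 1)
        ⟨by omega, ξ, h0, hξ⟩
      have hqt : q ≤ tilde W₀ Ωp s := le_tilde hs hq1 hq2 (by omega)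
      rw [← hq] at hξ
      have h2 := hξ.ladder_mem_EZero_sup_EPlus hΩ hW d⁻¹
      rw [hq, Nat.add_sub_cancel] at h2
      exact (le_iSup₂_of_le (f := fun q _ => EZero W₀ Ωp Ωm q ⊔ EPlus W₀ Ωp Ωm q) q
        (Finset.mem_Icc.mpr ⟨hq1, hqt⟩) le_rfl) h2
    have hV : d⁻¹ • ladder Ωm n ξ ∈ V W₀ 2 := by
      refine Submodule.smul_mem _ _ ?_
      convert ladder_mem_V hΩ hξ.1 n using 2
      push_cast; ring
    have hsub := ih (by omega) (sub_mem hZ hV) (by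
      rw [map_sub, map_smul, hDl, smul_smul, inv_mul_cancel₀ hd0, one_smul, sub_self])
    have := add_mem hsub hlad
    rwa [sub_add_cancel] at this

/-! ### Triple brackets -/

/-- Triple brackets of vectors of levels `a + 1`, `b + 1`, `c + 1` have level
`a + b + c + 1`. -/
lemma lie_lie_mem_filt [FiniteDimensional ℝ g₀] (hg₀ : IsCompactSemisimple g₀)
    {h : LieSubalgebra ℂ (Cplx g₀)} [h.IsCartanSubalgebra] (hW₀ : IsRegularIn h W₀)
    (hΩ : IsCompactTriple W₀ Ωp Ωm) (hW : W₀ ≠ 0) {a b c s : ℕ} (hs : a + b + c + 1 ≤ s)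
    {X Y Z : Cplx g₀} (hX : X ∈ levelSpace W₀ Ωp a) (hY : Y ∈ levelSpace W₀ Ωp b)
    (hZ : Z ∈ levelSpace W₀ Ωp c) :
    ⁅⁅conj X, Y⁆, Z⁆ ∈ filt W₀ Ωp Ωm (tilde W₀ Ωp s) := by
  have hYV := mem_V_of_mem_levelSpace hΩ hY
  have hZV := mem_V_of_mem_levelSpace hΩ hZ
  obtain ⟨-, hXV, hX0⟩ := hX
  obtain ⟨⟨H, hH, hHY, hH0⟩, -⟩ := hY
  obtain ⟨⟨K, hK, hKZ, hK0⟩, -⟩ := hZ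
  have hXY : ⁅conj X, Y⁆ ∈ V W₀ 0 := by simpa using lie_mem_V hXV hYV
  have hDX : ⁅Ωp, conj X⁆ ∈ V W₀ 0 := by simpa using lie_mem_V hΩ.Ωp_mem hXV
  refine mem_filt_of_ad_pow_eq_zero hΩ hW (by omega) hs ?_ ?_
  · simpa using lie_mem_V hXY hZV
  · exact ad_pow_lie_lie_eq_zero Ωp (T := (V W₀ 0 : Set (Cplx g₀)))
      (fun u hu v hv => lie_eq_zero_of_mem_V_zero hg₀ hW₀ hu hv)
      hDX hH hK hXY hHY hKZ hX0 hH0 hK0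

/-- In a sequence satisfying the hypotheses of the theorem the `n`-th vector has level
`max (n - 1) 1`. -/
lemma mem_levelSpace_of_mem_filt [FiniteDimensional ℝ g₀] (hΩ : IsCompactTriple W₀ Ωp Ωm)
    (hW : W₀ ≠ 0) {s : ℕ} {Z : ℕ → Cplx g₀} (hZ0 : Z 0 ∈ EZero W₀ Ωp Ωm 1 ⊔ EPlus W₀ Ωp Ωm 1)
    (hZ : ∀ n ≤ s, Z (n + 1) ∈ filt W₀ Ωp Ωm (tilde W₀ Ωp n)) {n : ℕ} (hn : n ≤ s + 1) :
    Z n ∈ levelSpace W₀ Ωp (n - 2) := by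
  cases n with
  | zero =>
    have hκ := (kappa_one hΩ hW).2
    exact EZero_sup_EPlus_le_levelSpace hΩ hκ.ge hκ.le hZ0
  | succ n => exact filt_tilde_le_levelSpace hΩ hW n (hZ n (by omega))

end EYM

theorem mainTheorem5 {g₀ : Type*} [LieRing g₀] [LieAlgebra ℝ g₀] [FiniteDimensional ℝ g₀]
    (hg₀ : EYM.IsCompactSemisimple g₀)
    (h : LieSubalgebra ℂ (EYM.Cplx g₀)) [h.IsCartanSubalgebra]
    (W₀ Ωp Ωm : EYM.Cplx g₀) (hΩ : EYM.IsCompactTriple W₀ Ωp Ωm)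
    (hW₀ : EYM.IsRegularIn h W₀)
    (s : ℕ) (hs : 1 ≤ s)
    (hsI : s ≤ EYM.kappa W₀ Ωp (EYM.numWeights W₀ Ωp) - 1)
    (Z₁ Z₂ : ℕ → EYM.Cplx g₀)
    (hZ₁V : ∀ n ≤ s + 1, Z₁ n ∈ EYM.V W₀ 2) (hZ₂V : ∀ n ≤ s + 1, Z₂ n ∈ EYM.V W₀ 2)
    (hZ₁0 : Z₁ 0 ∈ EYM.EZero W₀ Ωp Ωm 1 ⊔ EYM.EPlus W₀ Ωp Ωm 1)
    (hZ₂0 : Z₂ 0 ∈ EYM.EZero W₀ Ωp Ωm 1 ⊔ EYM.EPlus W₀ Ωp Ωm 1)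
    (hZ₁ : ∀ n ≤ s, Z₁ (n + 1) ∈ EYM.filt W₀ Ωp Ωm (EYM.tilde W₀ Ωp n))
    (hZ₂ : ∀ n ≤ s, Z₂ (n + 1) ∈ EYM.filt W₀ Ωp Ωm (EYM.tilde W₀ Ωp n)) :
    (∀ j, 1 ≤ j → j ≤ s + 1 →
      ⁅⁅EYM.conj (Z₂ (s + 2 - j)), Z₁ j⁆, Z₂ 0⁆ ∈ EYM.filt W₀ Ωp Ωm (EYM.tilde W₀ Ωp s) ∧
      ⁅⁅EYM.conj (Z₂ 0), Z₁ j⁆, Z₂ (s + 2 - j)⁆ ∈ EYM.filt W₀ Ωp Ωm (EYM.tilde W₀ Ωp s) ∧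
      ⁅⁅EYM.conj (Z₂ 0), Z₂ (s + 2 - j)⁆, Z₁ j⁆ ∈ EYM.filt W₀ Ωp Ωm (EYM.tilde W₀ Ωp s)) ∧
    (∀ j q, j ≤ s + 1 → q ≤ s + 1 → j ≤ q + 1 → q + 1 - j ≤ s + 1 →
      ⁅⁅EYM.conj (Z₁ j), Z₂ (q + 1 - j)⁆, Z₂ (s + 1 - q)⁆ ∈
        EYM.filt W₀ Ωp Ωm (EYM.tilde W₀ Ωp s)) := by
  have hW : W₀ ≠ 0 := EYM.ne_zero_of_one_le_kappa (hs.trans hsI)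
  have h₁ {n : ℕ} (hn : n ≤ s + 1) := EYM.mem_levelSpace_of_mem_filt hΩ hW hZ₁0 hZ₁ hn
  have h₂ {n : ℕ} (hn : n ≤ s + 1) := EYM.mem_levelSpace_of_mem_filt hΩ hW hZ₂0 hZ₂ hn
  -- The indices of each triple sum to `s + 2` and none exceeds `s + 1`. Since `n - 2` is truncated,
  -- it is the bound by `s + 1` that excludes two indices `0`, where the estimate would fail.
  refine ⟨fun j hj hjs => ⟨?_, ?_, ?_⟩, fun j q hj hq hjq hqj => ?_⟩
  · exact EYM.lie_lie_mem_filt hg₀ hW₀ hΩ hW (by omega) (h₂ (by omega)) (h₁ hjs) (h₂ (by omega))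
  · exact EYM.lie_lie_mem_filt hg₀ hW₀ hΩ hW (by omega) (h₂ (by omega)) (h₁ hjs) (h₂ (by omega))
  · exact EYM.lie_lie_mem_filt hg₀ hW₀ hΩ hW (by omega) (h₂ (by omega)) (h₂ (by omega)) (h₁ hjs)
  · exact EYM.lie_lie_mem_filt hg₀ hW₀ hΩ hW (by omega) (h₁ hj) (h₂ hqj) (h₂ (by omega))
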